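/- Let $(\widetilde M^{1,4},\tilde g)$ be a connected oriented five-dimensional Lorentzian manifold of signature $(+,-,-,-,-)$, let $(M^6,g)$ be a connected oriented six-dimensional Riemannian manifold with, in the same "mostly minus" convention, $g$ negative definite, and let $\mathsf X=\widetilde M^{1,4}\times M^6$ carry the product metric $h=\tilde g+g$ and the volume form $\mathrm{vol}_{\mathsf X}=\mathrm{vol}_{\widetilde M}\wedge\mathrm{vol}_M$ (all data smooth). For $k$-forms put $\langle\omega,\phi\rangle_h=\frac1{k!}\sum\omega_{i_1\dots i_k}\phi_{j_1\dots j_k}h^{i_1j_1}\cdots h^{i_kj_k}$ and $\|\omega\|_h^2=\langle\omega,\omega\rangle_h$, and let $\star$ be the Hodge operator defined by $\alpha\wedge\star\beta=\langle\alpha,\beta\rangle_h\,\mathrm{vol}_{\mathsf X}$. Let $\tilde\varpi\in\Omega^1(\widetilde M^{1,4})$ be null, i.e. $\langle\tilde\varpi,\tilde\varpi\rangle_{\tilde g}=0$, let $\epsilon\in\Omega^3(M^6)$, and let $\mathsf F=\tilde\varpi\wedge\epsilon\in\Omega^4(\mathsf X)$ (forms being pulled back to the product). Suppose that $(\mathsf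 X,h,\mathsf F)$ is a bosonic supergravity background, i.e. $$\mathrm d\mathsf F=0,\qquad \mathrm d\star\mathsf F=\tfrac12\,\mathsf F\wedge\mathsf F,\qquad \mathrm{Ric}_h(X,Y)=-\tfrac12\langle X\lrcorner\mathsf F,Y\lrcorner\mathsf F\rangle_h+\tfrac16\,h(X,Y)\,\|\mathsf F\|_h^2\quad\text{for all }X,Y.$$ Then $(\mathsf X,h)$ is totally Ricci-isotropic: the Ricci endomorphism $\mathrm{ric}$, defined by $h(\mathrm{ric}(X),Y)=\mathrm{Ric}_h(X,Y)$, satisfies $h(\mathrm{ric}(X),\mathrm{ric}(Y))=0$ for all $X,Y$. -/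

import Mathlib

open scoped Manifold ContDiff Topology
open Bundle

noncomputable section

namespace Sugra

/-! ### Multilinear algebra on a single vector space -/

section Algebra

variable {V : Type*} [AddCommGroup V] [Module ℝ V]

/-- The Gram matrix of a bilinear form in a basis. -/
def gram {ι : Type*} (b : Module.Basis ι ℝ V) (B : V → V → ℝ) : Matrix ι ι ℝ :=
  Matrix.of fun i j => B (b i) (b j)

/-- The inner product of two `k`-forms induced by a metric `B`,
`⟨τ, η⟩ = (1 / k!) ∑ τ_{i₁…i_k} η_{j₁…j_k} B^{i₁j₁} ⋯ B^{i_kj_k}`, where components are taken in the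
basis `b` and `(B^{ij})` is the inverse of the Gram matrix. Its value does not depend on `b`. -/
def formInner {ι : Type*} [Fintype ι] [DecidableEq ι] (b : Module.Basis ι ℝ V) (B : V → V → ℝ)
    {k : ℕ} (τ η : V [⋀^Fin k]→ₗ[ℝ] ℝ) : ℝ :=
  (k.factorial : ℝ)⁻¹ * ∑ i : Fin k → ι, ∑ j : Fin k → ι,
    τ (fun a => b (i a)) * η (fun a => b (j a)) * ∏ a : Fin k, (gram b B)⁻¹ (i a) (j a)

/-- The interior product `X ⌟ τ = τ(X, ·, …, ·)`. -/
def interior {k : ℕ} (X : V) (τ : V [⋀^Fin (k + 1)]→ₗ[ℝ] ℝ) : V [⋀^Fin k]→ₗ[ℝ] ℝ :=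
  τ.curryLeft X

variable [TopologicalSpace V]

/-- The multilinear map `(v₁, …, vₙ) ↦ τ(v₁, …, v_k) η(v_{k+1}, …, v_{k+l})`, where `n = k + l`. -/
def tensorForm {k l n : ℕ} (h : k + l = n) (τ : V [⋀^Fin k]→L[ℝ] ℝ) (η : V [⋀^Fin l]→L[ℝ] ℝ) :
    ContinuousMultilinearMap ℝ (fun _ : Fin n => V) ℝ where
  toMultilinearMap := (LinearMap.mul' ℝ ℝ).compMultilinearMap
    ((MultilinearMap.domCoprod τ.toMultilinearMap η.toMultilinearMap).domDomCongr
      (finSumFinEquiv.trans (finCongr h)))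
  cont := by
    exact (τ.cont.comp (by fun_prop)).mul (η.cont.comp (by fun_prop))

theorem tensorForm_apply {k l n : ℕ} (h : k + l = n) (τ : V [⋀^Fin k]→L[ℝ] ℝ)
    (η : V [⋀^Fin l]→L[ℝ] ℝ) (v : Fin n → V) :
    tensorForm h τ η v =
      τ (fun i => v (Fin.cast h (Fin.castAdd l i))) *
        η (fun j => v (Fin.cast h (Fin.natAdd k j))) := rfl

/-- The wedge product of a `k`-form and an `l`-form,
`(τ ∧ η)(v₁, …, vₙ) = (1 / (k! l!)) ∑_σ sign(σ) τ(v_{σ1}, …, v_{σk}) η(v_{σ(k+1)}, …, v_{σn})`,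
where `n = k + l`. -/
def wedge {k l n : ℕ} (h : k + l = n) (τ : V [⋀^Fin k]→L[ℝ] ℝ) (η : V [⋀^Fin l]→L[ℝ] ℝ) :
    V [⋀^Fin n]→L[ℝ] ℝ :=
  ((k.factorial * l.factorial : ℕ) : ℝ)⁻¹ • (tensorForm h τ η).alternatization

/-- The volume form of a metric `B` on an oriented `n`-dimensional vector space: on a positively
oriented basis `e` it takes the value `√|det (B(eᵢ, eⱼ))|`. The basis `b` serves only to write down
one positively oriented basis; the result does not depend on it. -/
def volumeElement [IsTopologicalAddGroup V] [ContinuousSMul ℝ V] [T2Space V] {n : ℕ} [NeZero n]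
    (b : Module.Basis (Fin n) ℝ V) (B : V → V → ℝ) (o : Orientation ℝ V (Fin n)) :
    V [⋀^Fin n]→L[ℝ] ℝ :=
  √|(gram (b.adjustToOrientation o) B).det| •
    { (b.adjustToOrientation o).det with
      cont := by
        have : FiniteDimensional ℝ V := Module.Basis.finiteDimensional_of_finite b
        have h : ∀ i, Continuous fun v : V => (b.adjustToOrientation o).repr v i := fun i =>
          LinearMap.continuous_of_finiteDimensional ((b.adjustToOrientation o).coord i)
        change Continuous fun v : Fin n → V => (b.adjustToOrientation o).det v
        simp only [Module.Basis.det_apply]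
        refine Continuous.matrix_det (continuous_matrix fun i j => ?_)
        exact (h i).comp (continuous_apply j) }

end Algebra

/-! ### Metrics and differential forms on a manifold without boundary -/

section Manifold

variable {E : Type*} [NormedAddCommGroup E] [NormedSpace ℝ E]
  {H : Type*} [TopologicalSpace H] (I : ModelWithCorners ℝ E H)
  (M : Type*) [TopologicalSpace M] [ChartedSpace H M]

/-- Fields of bilinear forms on the tangent spaces of `M`. -/
abbrev MetricField : Type _ := ∀ x : M, TangentSpace I x →L[ℝ] TangentSpace I x →L[ℝ] ℝ

/-- Fields of alternating `k`-forms on the tangent spaces of `M` (not necessarily smooth). -/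
abbrev FormField (k : ℕ) : Type _ := ∀ x : M, TangentSpace I x [⋀^Fin k]→L[ℝ] ℝ

variable {I M}

/-- A pseudo-Riemannian metric: a smooth field of symmetric, non-degenerate bilinear forms. -/
structure IsPseudoRiemannian [IsManifold I ∞ M] (g : MetricField I M) : Prop where
  symm : ∀ x (v w : TangentSpace I x), g x v w = g x w v
  nondegenerate : ∀ x (v : TangentSpace I x), (∀ w, g x v w = 0) → v = 0
  smooth : ContMDiff I (I.prod 𝓘(ℝ, E →L[ℝ] E →L[ℝ] ℝ)) ∞
    (fun x => TotalSpace.mk' (E →L[ℝ] E →L[ℝ] ℝ) (E := fun x : M =>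
      TangentSpace I x →L[ℝ] TangentSpace I x →L[ℝ] Trivial M ℝ x) x (g x))

/-- A Lorentzian metric in the "mostly minus" convention: every tangent space has a basis in which
`g = diag(1, -1, …, -1)`. -/
structure IsLorentzian [IsManifold I ∞ M] (n : ℕ) [NeZero n] (g : MetricField I M) : Prop extends
    IsPseudoRiemannian g where
  signature : ∀ x, ∃ e : Module.Basis (Fin n) ℝ (TangentSpace I x), ∀ i j,
    g x (e i) (e j) = if i = j then (if i = 0 then 1 else -1) else 0

/-- A Riemannian metric in the "mostly minus" convention, i.e. a negative definite one. -/
structure IsNegRiemannian [IsManifold I ∞ M] (g : MetricField I M) : Prop extends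
    IsPseudoRiemannian g where
  neg : ∀ x (v : TangentSpace I x), v ≠ 0 → g x v v < 0

/-- Smooth `k`-forms: smooth sections of the bundle of alternating `k`-forms. -/
def IsSmoothForm [IsManifold I ∞ M] {k : ℕ} (τ : FormField I M k) : Prop :=
  ContMDiff I (I.prod 𝓘(ℝ, E [⋀^Fin k]→L[ℝ] ℝ)) ∞
    (fun x => TotalSpace.mk' (E [⋀^Fin k]→L[ℝ] ℝ) (E := fun x : M =>
      TangentSpace I x [⋀^Fin k]→L[ℝ] Trivial M ℝ x) x (τ x))

/-- The coordinate expression of a form in the chart around `x₀`, i.e. its pullback to the model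
space under the inverse of this chart. -/
def localForm {k : ℕ} (τ : FormField I M k) (x₀ : M) (y : E) : E [⋀^Fin k]→L[ℝ] ℝ :=
  (τ ((extChartAt I x₀).symm y)).compContinuousLinearMap
    (mfderiv 𝓘(ℝ, E) I (extChartAt I x₀).symm y)

/-- The exterior derivative of a form, computed at `x` in the chart around `x`. -/
def dForm {k : ℕ} (τ : FormField I M k) : FormField I M (k + 1) := fun x =>
  (extDeriv (localForm τ x) (extChartAt I x x)).compContinuousLinearMap
    (mfderiv I 𝓘(ℝ, E) (extChartAt I x) x)

/-- The wedge product of two form fields. -/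
def wedgeForm {k l n : ℕ} (h : k + l = n) (τ : FormField I M k) (η : FormField I M l) :
    FormField I M n := fun x => wedge h (τ x) (η x)

/-- An orientation of a manifold: orientations of the tangent spaces that near every point are
given by a smooth form of top degree. -/
def IsManifoldOrientation [IsManifold I ∞ M] {n : ℕ}
    (o : ∀ x : M, Orientation ℝ (TangentSpace I x) (Fin n)) : Prop :=
  ∀ x₀ : M, ∃ η : FormField I M n, IsSmoothForm η ∧
    ∀ᶠ x in 𝓝 x₀, ∃ h : (η x).toAlternatingMap ≠ 0, o x = rayOfNeZero ℝ _ h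

/-- A basis of the model space, seen as a basis of the tangent space at `x`. -/
def tangentBasis {ι : Type*} (b : Module.Basis ι ℝ E) (x : M) :
    Module.Basis ι ℝ (TangentSpace I x) := b

section Metric

variable {ι : Type*} [Fintype ι] [DecidableEq ι] (b : Module.Basis ι ℝ E)

/-- The inner product `⟨τ, η⟩_g` of two forms on the tangent space at `x`. -/
def innerAt (g : MetricField I M) {k : ℕ} (x : M)
    (τ η : TangentSpace I x [⋀^Fin k]→ₗ[ℝ] ℝ) : ℝ :=
  formInner (tangentBasis b x) (fun v w => g x v w) τ η

/-- A form field is null if `⟨τ, τ⟩_g = 0` everywhere. -/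
def IsNullForm (g : MetricField I M) {k : ℕ} (τ : FormField I M k) : Prop :=
  ∀ x, innerAt b g x (τ x).toAlternatingMap (τ x).toAlternatingMap = 0

/-- `γ = ⋆β` for the metric `g` and the volume form `vol`, i.e. `α ∧ γ = ⟨α, β⟩_g vol` for all `α`;
for a non-degenerate metric this determines `γ` pointwise, and `γ` is smooth when `g`, `vol` and
`β` are. -/
def IsHodgeStar (g : MetricField I M) {k l n : ℕ} (h : k + l = n) (vol : FormField I M n)
    (β : FormField I M k) (γ : FormField I M l) : Prop :=
  ∀ (x : M) (α : TangentSpace I x [⋀^Fin k]→L[ℝ] ℝ),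
    wedge h α (γ x) = innerAt b g x α.toAlternatingMap (β x).toAlternatingMap • vol x

/-- The components `g_{ij}` of the metric in the chart around `x₀`. -/
def coordMetric (g : MetricField I M) (x₀ : M) (y : E) : Matrix ι ι ℝ :=
  Matrix.of fun i j => g ((extChartAt I x₀).symm y)
    (mfderiv 𝓘(ℝ, E) I (extChartAt I x₀).symm y (b i))
    (mfderiv 𝓘(ℝ, E) I (extChartAt I x₀).symm y (b j))

/-- The partial derivative in the direction of the `i`-th coordinate. -/
def partialDeriv (i : ι) (f : E → ℝ) (y : E) : ℝ := fderiv ℝ f y (b i)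

/-- The Christoffel symbols
`Γ^k_{ij} = (1/2) ∑_l g^{kl} (∂_i g_{jl} + ∂_j g_{il} - ∂_l g_{ij})` in the chart around `x₀`. -/
def christoffel (g : MetricField I M) (x₀ : M) (k i j : ι) (y : E) : ℝ :=
  (1 / 2) * ∑ l, (coordMetric b g x₀ y)⁻¹ k l *
    (partialDeriv b i (fun z => coordMetric b g x₀ z j l) y +
      partialDeriv b j (fun z => coordMetric b g x₀ z i l) y -
      partialDeriv b l (fun z => coordMetric b g x₀ z i j) y)

/-- The components `R_{jk} = ∑_i (∂_i Γ^i_{jk} - ∂_j Γ^i_{ik}) +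
∑_{i,p} (Γ^i_{ip} Γ^p_{jk} - Γ^i_{jp} Γ^p_{ik})` of the Ricci tensor in the chart around `x₀`. -/
def coordRicci (g : MetricField I M) (x₀ : M) (j k : ι) (y : E) : ℝ :=
  ∑ i, (partialDeriv b i (christoffel b g x₀ i j k) y -
      partialDeriv b j (christoffel b g x₀ i i k) y) +
    ∑ i, ∑ p, (christoffel b g x₀ i i p y * christoffel b g x₀ p j k y -
      christoffel b g x₀ i j p y * christoffel b g x₀ p i k y)

/-- The Ricci tensor `Ric_g(X, Y)` of the Levi-Civita connection of `g`, for `X`, `Y` tangent at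
`x`, computed in the chart around `x`. -/
def ricci (g : MetricField I M) (x : M) (X Y : TangentSpace I x) : ℝ :=
  ∑ j, ∑ k, coordRicci b g x j k (extChartAt I x x) *
    b.repr (mfderiv I 𝓘(ℝ, E) (extChartAt I x) x X) j *
    b.repr (mfderiv I 𝓘(ℝ, E) (extChartAt I x) x Y) k

/-- `ric` is the Ricci endomorphism of `g`: `g(ric X, Y) = Ric_g(X, Y)`. For a non-degenerate metric
there is exactly one such field of endomorphisms. -/
def IsRicciEndomorphism (g : MetricField I M)
    (ric : ∀ x : M, TangentSpace I x →ₗ[ℝ] TangentSpace I x) : Prop :=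
  ∀ x (X Y : TangentSpace I x), g x (ric x X) Y = ricci b g x X Y

/-- The metric is totally Ricci-isotropic: its Ricci endomorphism satisfies
`g(ric X, ric Y) = 0` for all `X`, `Y`. -/
def IsTotallyRicciIsotropic (g : MetricField I M) : Prop :=
  ∃ ric : ∀ x : M, TangentSpace I x →ₗ[ℝ] TangentSpace I x, IsRicciEndomorphism b g ric ∧
    ∀ x (X Y : TangentSpace I x), g x (ric x X) (ric x Y) = 0

/-- The volume form of an oriented pseudo-Riemannian manifold. -/
def volumeForm {n : ℕ} [NeZero n] (b : Module.Basis (Fin n) ℝ E) (g : MetricField I M)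
    (o : ∀ x : M, Orientation ℝ (TangentSpace I x) (Fin n)) : FormField I M n := fun x =>
  haveI : T2Space (TangentSpace I x) := inferInstanceAs (T2Space E)
  volumeElement (tangentBasis b x) (fun v w => g x v w) (o x)

/-- The bosonic equations of eleven-dimensional supergravity ("mostly minus" convention) for a
metric `h` with volume form `vol` and a smooth flux 4-form `F`: closedness `dF = 0`, the Maxwell
equation `d⋆F = (1/2) F ∧ F`, and the supergravity Einstein equation
`Ric_h(X, Y) = -(1/2) ⟨X ⌟ F, Y ⌟ F⟩_h + (1/6) h(X, Y) ‖F‖²_h`. -/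
structure IsBosonicBackground [IsManifold I ∞ M] (h : MetricField I M) (vol : FormField I M 11)
    (F : FormField I M 4) : Prop where
  smooth : IsSmoothForm F
  closed : dForm F = 0
  maxwell : ∃ G : FormField I M 7, IsHodgeStar b h rfl vol F G ∧
    dForm G = (1 / 2 : ℝ) • wedgeForm rfl F F
  einstein : ∀ x (X Y : TangentSpace I x),
    ricci b h x X Y =
      -(1 / 2) * innerAt b h x (interior X (F x).toAlternatingMap)
          (interior Y (F x).toAlternatingMap) +
        (1 / 6) * h x X Y * innerAt b h x (F x).toAlternatingMap (F x).toAlternatingMap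

end Metric

/-! ### Products -/

variable {E' : Type*} [NormedAddCommGroup E'] [NormedSpace ℝ E']
  {H' : Type*} [TopologicalSpace H'] {J : ModelWithCorners ℝ E' H'}
  {N : Type*} [TopologicalSpace N] [ChartedSpace H' N]

/-- The pullback of a form along a map. -/
def pullbackForm (f : M → N) {k : ℕ} (τ : FormField J N k) : FormField I M k := fun x =>
  (τ (f x)).compContinuousLinearMap (mfderiv I J f x)

/-- The product metric `h = g + g'` on `M × N`, i.e. the sum of the pullbacks of `g` and `g'`. -/
def productMetric (g : MetricField I M) (g' : MetricField J N) :
    MetricField (I.prod J) (M × N) := fun z =>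
  ContinuousLinearMap.bilinearComp (E := E) (F := E) (E' := E × E') (F' := E × E') (g z.1)
      (mfderiv (I.prod J) I Prod.fst z) (mfderiv (I.prod J) I Prod.fst z) +
    ContinuousLinearMap.bilinearComp (E := E') (F := E') (E' := E × E') (F' := E × E') (g' z.2)
      (mfderiv (I.prod J) J Prod.snd z) (mfderiv (I.prod J) J Prod.snd z)

/-- The exterior product `τ ∧ η` on `M × N` of a form on `M` and a form on `N`, i.e. the wedge
product of their pullbacks under the projections. -/
def productForm {k l n : ℕ} (h : k + l = n) (τ : FormField I M k) (η : FormField J N l) :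
    FormField (I.prod J) (M × N) n :=
  wedgeForm h (pullbackForm Prod.fst τ) (pullbackForm Prod.snd η)

end Manifold

/-- The standard basis of `ℝⁿ`. -/
def stdBasis (n : ℕ) : Module.Basis (Fin n) ℝ (EuclideanSpace ℝ (Fin n)) :=
  (EuclideanSpace.basisFun (Fin n) ℝ).toBasis

/-- The standard basis of `ℝ^m × ℝ^n`. -/
def stdBasisProd (m n : ℕ) :
    Module.Basis (Fin m ⊕ Fin n) ℝ (EuclideanSpace ℝ (Fin m) × EuclideanSpace ℝ (Fin n)) :=
  (stdBasis m).prod (stdBasis n)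

end Sugra

end

/-! Let `u` be the metric dual of the null form `ϖ`. It is tangent to the Lorentzian factor, so `ε`
annihilates it, and `ϖ(u) = ⟨ϖ, ϖ⟩ = 0`; hence `u ⌟ F = 0` for `F = ϖ ∧ ε`. Contracting any form
with `ϖ` in one slot inserts `u` there, so a form divisible by `ϖ` is orthogonal to every form that
`u` annihilates (`sum_contract_eq_zero`). This gives `‖F‖² = 0`. It also gives `⟨Z ⌟ F, X ⌟ F⟩ = 0`
for every `X` whenever `ϖ(Z) = 0`, since then `Z ⌟ F = -ϖ ∧ (Z ⌟ ε)`.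

By the Einstein equation `Ric(X, Z) = 0` for all `X` and all `Z` in `ker ϖ`. As `u` lies in `ker ϖ`,
`ϖ(ric Y) = h(u, ric Y) = Ric(Y, u) = 0`, so `ric Y` lies in `ker ϖ` too, and `h(ric X, ric Y) =
Ric(X, ric Y) = 0`. -/

namespace Sugra

/-! ### Inner products of forms and contraction with a dual vector -/

section Contraction

variable {V : Type*} [AddCommGroup V] [Module ℝ V] {ι : Type*} [Fintype ι] [DecidableEq ι]

/-- The basis vectors with their index raised. -/
noncomputable def raisedBasis (b : Module.Basis ι ℝ V) (B : V → V → ℝ) (i : ι) : V :=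
  ∑ j, (gram b B)⁻¹ i j • b j

theorem sum_mul_prod_eq_apply_raisedBasis (b : Module.Basis ι ℝ V) (B : V → V → ℝ) {k : ℕ}
    (η : V [⋀^Fin k]→ₗ[ℝ] ℝ) (i : Fin k → ι) :
    ∑ j : Fin k → ι, η (fun a => b (j a)) * ∏ a : Fin k, (gram b B)⁻¹ (i a) (j a) =
      η (fun a => raisedBasis b B (i a)) := by
  simp only [raisedBasis]
  rw [← AlternatingMap.coe_multilinearMap, MultilinearMap.map_sum]
  refine Finset.sum_congr rfl fun j _ => ?_
  rw [MultilinearMap.map_smul_univ, smul_eq_mul, mul_comm]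

/-- Absorbing the inverse Gram matrices into the arguments of `η` leaves a single sum, in which a
covector factor of `τ` can be contracted into `η`. -/
theorem formInner_eq_sum_raisedBasis (b : Module.Basis ι ℝ V) (B : V → V → ℝ) {k : ℕ}
    (τ η : V [⋀^Fin k]→ₗ[ℝ] ℝ) :
    formInner b B τ η = (k.factorial : ℝ)⁻¹ * ∑ i : Fin k → ι,
      τ (fun a => b (i a)) * η (fun a => raisedBasis b B (i a)) := by
  simp only [formInner, ← sum_mul_prod_eq_apply_raisedBasis, Finset.mul_sum, mul_assoc]

theorem formInner_comm (b : Module.Basis ι ℝ V) {B : V → V → ℝ} (hB : ∀ v w, B v w = B w v)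
    {k : ℕ} (τ η : V [⋀^Fin k]→ₗ[ℝ] ℝ) : formInner b B τ η = formInner b B η τ := by
  have hs : (gram b B)⁻¹.IsSymm := by
    have : (gram b B).IsSymm := Matrix.IsSymm.ext fun i j => hB _ _
    rw [Matrix.IsSymm, Matrix.transpose_nonsing_inv, this.eq]
  unfold formInner
  rw [Finset.sum_comm]
  congr 1
  refine Finset.sum_congr rfl fun j _ => Finset.sum_congr rfl fun i _ => ?_
  rw [mul_comm (τ _)]
  congr 1
  exact Finset.prod_congr rfl fun a _ => hs.apply _ _

theorem isUnit_det_gram (b : Module.Basis ι ℝ V) (B : V →ₗ[ℝ] V →ₗ[ℝ] ℝ)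
    (hB : ∀ v, (∀ w, B v w = 0) → v = 0) : IsUnit (gram b fun v w => B v w).det := by
  rw [isUnit_iff_ne_zero]
  intro h
  obtain ⟨c, hc, h0⟩ := Matrix.exists_vecMul_eq_zero_iff.2 h
  refine hc (funext fun i => ?_)
  -- A vector in the left kernel of the Gram matrix is the coordinate vector of an element of the
  -- radical of `B`.
  have hv : ∑ i, c i • b i = 0 := hB _ fun w => by
    have : B (∑ i, c i • b i) = 0 := b.ext fun j => by
      simpa [Matrix.vecMul, dotProduct, gram, LinearMap.sum_apply] using congrFun h0 j
    rw [this, LinearMap.zero_apply]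
  exact Fintype.linearIndependent_iff.1 b.linearIndependent c hv i

/-- Raising the index of the covector `B u`. -/
theorem sum_smul_raisedBasis (b : Module.Basis ι ℝ V) (B : V →ₗ[ℝ] V →ₗ[ℝ] ℝ)
    (hB : ∀ v, (∀ w, B v w = 0) → v = 0) (u : V) :
    ∑ i, B u (b i) • raisedBasis b (fun v w => B v w) i = u := by
  set G := gram b fun v w => B v w with hG
  have hu : ∀ i, B u (b i) = Matrix.vecMul (b.repr u) G i := fun i => by
    conv_lhs => rw [← b.sum_repr u, map_sum, LinearMap.sum_apply]
    simp only [map_smul, LinearMap.smul_apply, smul_eq_mul]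
    rfl
  have h : Matrix.vecMul (Matrix.vecMul (b.repr u) G) G⁻¹ = b.repr u := by
    rw [Matrix.vecMul_vecMul, Matrix.mul_nonsing_inv _ (isUnit_det_gram b B hB),
      Matrix.vecMul_one]
  conv_rhs => rw [← b.sum_repr u]
  simp only [raisedBasis, Finset.smul_sum, smul_smul]
  rw [Finset.sum_comm]
  refine Finset.sum_congr rfl fun j _ => ?_
  rw [← Finset.sum_smul, ← congrFun h j]
  simp only [hu]
  rfl

/-- Contracting the `a`-th slot of `η` with the covector `B u` inserts `u` into that slot. -/
theorem sum_contract_eq_zero (b : Module.Basis ι ℝ V) (B : V →ₗ[ℝ] V →ₗ[ℝ] ℝ)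
    (hB : ∀ v, (∀ w, B v w = 0) → v = 0) (u : V) {k : ℕ} (η : V [⋀^Fin k]→ₗ[ℝ] ℝ)
    (a : Fin k) (hη : ∀ v, v a = u → η v = 0) (R : (Fin k → ι) → ℝ)
    (hR : ∀ i x, R (Function.update i a x) = R i) :
    ∑ i : Fin k → ι, B u (b (i a)) * R i *
      η (fun c => raisedBasis b (fun v w => B v w) (i c)) = 0 := by
  obtain _ | n := k
  · exact a.elim0
  -- Split off the index in slot `a`. With the other indices `p` fixed, `R` is constant and the
  -- remaining sum is `η` with `u` in slot `a`.
  rw [← (Fin.insertNthEquiv (fun _ => ι) a).sum_comp, Fintype.sum_prod_type, Finset.sum_comm]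
  refine Finset.sum_eq_zero fun p _ => ?_
  -- `x₀` is an arbitrary filler for slot `a`, needed only to have a base tuple to update.
  obtain hι | ⟨⟨x₀⟩⟩ := isEmpty_or_nonempty ι
  · simp
  set v₀ : Fin (n + 1) → V := fun c =>
    raisedBasis b (fun v w => B v w) (a.insertNth (α := fun _ => ι) x₀ p c)
  have hv : ∀ x, (fun c => raisedBasis b (fun v w => B v w)
      (a.insertNth (α := fun _ => ι) x p c)) =
      Function.update v₀ a (raisedBasis b (fun v w => B v w) x) := fun x => by
    funext c
    refine Fin.succAboveCases a ?_ (fun c => ?_) c <;> simp [v₀]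
  have hr : ∀ x, R (a.insertNth (α := fun _ => ι) x p) =
      R (a.insertNth (α := fun _ => ι) x₀ p) := fun x => by
    rw [← hR (a.insertNth (α := fun _ => ι) x₀ p) x]
    congr 1
    funext c
    refine Fin.succAboveCases a ?_ (fun c => ?_) c <;> simp
  have h0 : η (Function.update v₀ a u) = 0 := hη _ (Function.update_self ..)
  rw [← sum_smul_raisedBasis b B hB u, AlternatingMap.map_update_sum] at h0
  simp only [AlternatingMap.map_update_smul, smul_eq_mul] at h0
  simp only [Fin.insertNthEquiv_apply, Fin.insertNth_apply_same, hv]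
  rw [← mul_zero (R (a.insertNth (α := fun _ => ι) x₀ p)), ← h0, Finset.mul_sum]
  refine Finset.sum_congr rfl fun x _ => ?_
  rw [show R (Fin.insertNthEquiv (fun _ => ι) a (x, p)) = _ from hr x]
  ring

/-- A null covector is annihilated by its own sharp. -/
theorem apply_eq_zero_of_formInner_self_eq_zero (b : Module.Basis ι ℝ V)
    (B : V →ₗ[ℝ] V →ₗ[ℝ] ℝ) (hB : ∀ v, (∀ w, B v w = 0) → v = 0) (u : V)
    (φ : V [⋀^Fin 1]→ₗ[ℝ] ℝ) (hu : ∀ v, B u v = φ fun _ => v)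
    (h : formInner b (fun v w => B v w) φ φ = 0) : (φ fun _ => u) = 0 := by
  rw [formInner_eq_sum_raisedBasis, Nat.factorial_one, Nat.cast_one, inv_one, one_mul,
    ← (Equiv.funUnique (Fin 1) ι).symm.sum_comp] at h
  rw [← hu, ← h, show B u u = B u (∑ i, B u (b i) • raisedBasis b (fun v w => B v w) i) by
    rw [sum_smul_raisedBasis b B hB u], map_sum]
  refine Finset.sum_congr rfl fun i _ => ?_
  rw [map_smul, smul_eq_mul, hu, hu]
  rfl

/-! ### Wedge products with a null covector -/

variable [TopologicalSpace V] {l n : ℕ} (h : 1 + l = n)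
  (φ : V [⋀^Fin 1]→L[ℝ] ℝ) (ψ : V [⋀^Fin l]→L[ℝ] ℝ)

theorem wedge_one_apply (v : Fin n → V) :
    wedge h φ ψ v = ((Nat.factorial 1 * l.factorial : ℕ) : ℝ)⁻¹ * ∑ σ : Equiv.Perm (Fin n),
      ((Equiv.Perm.sign σ : ℤ) : ℝ) * (φ (fun _ => v (σ (Fin.cast h (Fin.castAdd l 0)))) *
        ψ fun j => v (σ (Fin.cast h (Fin.natAdd 1 j)))) := by
  simp only [wedge, ContinuousAlternatingMap.smul_apply, smul_eq_mul,
    ContinuousMultilinearMap.alternatization_apply_apply]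
  congr 1
  refine Finset.sum_congr rfl fun σ _ => ?_
  simp only [tensorForm_apply, Units.smul_def, zsmul_eq_mul, Function.comp_def,
    Fin.fin_one_eq_zero]

/-- The wedge product vanishes on a vector that both factors annihilate. -/
theorem wedge_one_eq_zero {u : V} (hφ : (φ fun _ => u) = 0) (hψ : ∀ v j, v j = u → ψ v = 0)
    {v : Fin n → V} {a : Fin n} (ha : v a = u) : wedge h φ ψ v = 0 := by
  rw [wedge_one_apply, Finset.sum_eq_zero, mul_zero]
  intro σ _
  obtain ⟨c, rfl⟩ := σ.surjective a
  obtain ⟨c, rfl⟩ := (finCongr h).surjective c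
  rw [finCongr_apply] at ha
  induction c using Fin.addCases with
  | left c =>
    rw [Subsingleton.elim c 0] at ha
    simp [ha, hφ]
  | right c => simp [hψ (fun j => v (σ (Fin.cast h (Fin.natAdd 1 j)))) c ha]

/-- Expand only one of the two copies of the wedge over permutations: in each term `φ = B u` is
contracted into the other copy, which `u` annihilates. -/
theorem formInner_wedge_one_self_eq_zero (b : Module.Basis ι ℝ V)
    (B : V →ₗ[ℝ] V →ₗ[ℝ] ℝ) (hB : ∀ v, (∀ w, B v w = 0) → v = 0) {u : V}
    (hu : ∀ v, B u v = φ fun _ => v) (hφ : (φ fun _ => u) = 0)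
    (hψ : ∀ v j, v j = u → ψ v = 0) :
    formInner b (fun v w => B v w) (wedge h φ ψ).toAlternatingMap
      (wedge h φ ψ).toAlternatingMap = 0 := by
  rw [formInner_eq_sum_raisedBasis]
  refine mul_eq_zero_of_right _ ?_
  set η := (wedge h φ ψ).toAlternatingMap
  have hF : ∀ v, η v = _ := wedge_one_apply h φ ψ
  conv_lhs => enter [2, i]; rw [hF fun a => b (i a), mul_assoc, Finset.sum_mul]
  rw [← Finset.mul_sum, Finset.sum_comm]
  refine mul_eq_zero_of_right _ (Finset.sum_eq_zero fun σ _ => ?_)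
  simp only [mul_assoc, ← Finset.mul_sum]
  refine mul_eq_zero_of_right _ ?_
  simp only [← mul_assoc, ← hu]
  refine sum_contract_eq_zero b B hB u η (σ (Fin.cast h (Fin.castAdd l 0)))
    (fun v hv => wedge_one_eq_zero h φ ψ hφ hψ hv)
    (fun i => ψ fun j => b (i (σ (Fin.cast h (Fin.natAdd 1 j))))) fun i x => ?_
  refine congrArg ψ (funext fun j => ?_)
  -- The slots fed to `ψ` differ from the one fed to `φ`, as `σ` is injective.
  rw [Function.update_of_ne]
  intro hj
  have := congrArg Fin.val (σ.injective hj)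
  simp at this

/-- In each term of the expansion, `φ` receives either `Z`, which it kills, or a basis vector, and
then the contraction puts `u` into `X ⌟ (φ ∧ ψ)`. -/
theorem formInner_interior_wedge_one_eq_zero {l : ℕ} {h : 1 + l = n + 1}
    (ψ : V [⋀^Fin l]→L[ℝ] ℝ) (b : Module.Basis ι ℝ V)
    (B : V →ₗ[ℝ] V →ₗ[ℝ] ℝ) (hB : ∀ v, (∀ w, B v w = 0) → v = 0) {u : V}
    (hu : ∀ v, B u v = φ fun _ => v) (hφ : (φ fun _ => u) = 0)
    (hψ : ∀ v j, v j = u → ψ v = 0) {Z : V} (hZ : (φ fun _ => Z) = 0) (X : V) :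
    formInner b (fun v w => B v w) (interior Z (wedge h φ ψ).toAlternatingMap)
      (interior X (wedge h φ ψ).toAlternatingMap) = 0 := by
  rw [formInner_eq_sum_raisedBasis]
  refine mul_eq_zero_of_right _ ?_
  set η := interior X (wedge h φ ψ).toAlternatingMap with hη
  have hF : ∀ v, interior Z (wedge h φ ψ).toAlternatingMap v = _ :=
    fun v => wedge_one_apply h φ ψ (Matrix.vecCons Z v)
  conv_lhs => enter [2, i]; rw [hF fun a => b (i a), mul_assoc, Finset.sum_mul]
  rw [← Finset.mul_sum, Finset.sum_comm]
  refine mul_eq_zero_of_right _ (Finset.sum_eq_zero fun σ _ => ?_)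
  simp only [mul_assoc, ← Finset.mul_sum]
  refine mul_eq_zero_of_right _ ?_
  simp only [← mul_assoc, ← hu]
  obtain hs | ⟨a, ha⟩ := Fin.eq_zero_or_eq_succ (σ (Fin.cast h (Fin.castAdd l 0)))
  · simp [hs, hu, hZ]
  simp only [ha, Matrix.cons_val_succ]
  -- Slot `a` of the interior product is slot `a.succ` of the wedge, since `X` occupies slot `0`.
  refine sum_contract_eq_zero b B hB u η a
    (fun v hv => wedge_one_eq_zero h φ ψ hφ hψ (v := Matrix.vecCons X v) (a := a.succ) (by simpa))
    (fun i => ψ fun j => Matrix.vecCons Z (fun a => b (i a)) (σ (Fin.cast h (Fin.natAdd 1 j))))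
    fun i x => ?_
  refine congrArg ψ (funext fun j => ?_)
  -- An argument of `ψ` is either `Z`, independent of `i`, or a basis vector from a slot other than
  -- `a`.
  obtain hs | ⟨c, hc⟩ := Fin.eq_zero_or_eq_succ (σ (Fin.cast h (Fin.natAdd 1 j)))
  · simp [hs]
  simp only [hc, Matrix.cons_val_succ]
  rw [Function.update_of_ne]
  rintro rfl
  have := congrArg Fin.val (σ.injective (hc.trans ha.symm))
  simp at this

end Contraction

theorem surjective_of_nondegenerate {V : Type*} [AddCommGroup V] [Module ℝ V] [FiniteDimensional ℝ V]
    (B : V →ₗ[ℝ] V →ₗ[ℝ] ℝ) (hB : ∀ v, (∀ w, B v w = 0) → v = 0) :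
    Function.Surjective B :=
  (LinearMap.injective_iff_surjective_of_finrank_eq_finrank Subspace.dual_finrank_eq.symm).1 <|
    (injective_iff_map_eq_zero B).2 fun v hv => hB v fun w => by rw [hv, LinearMap.zero_apply]

/-! ### Ricci tensor and product metric; the isotropy argument -/

section Manifold

variable {E : Type*} [NormedAddCommGroup E] [NormedSpace ℝ E]
  {H : Type*} [TopologicalSpace H] {I : ModelWithCorners ℝ E H}
  {M : Type*} [TopologicalSpace M] [ChartedSpace H M]

/-- The coordinate covectors of the chart around `x`. -/
noncomputable def chartCovector {ι : Type*} (b : Module.Basis ι ℝ E) (x : M) (j : ι) :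
    TangentSpace I x →ₗ[ℝ] ℝ :=
  b.coord j ∘ₗ (show TangentSpace I x →L[ℝ] E from
    mfderiv I 𝓘(ℝ, E) (extChartAt I x) x).toLinearMap

/-- The Ricci tensor as a bilinear form. -/
noncomputable def ricciForm {ι : Type*} [Fintype ι] [DecidableEq ι] (b : Module.Basis ι ℝ E)
    (g : MetricField I M) (x : M) : TangentSpace I x →ₗ[ℝ] TangentSpace I x →ₗ[ℝ] ℝ :=
  ∑ j, ∑ k, coordRicci b g x j k (extChartAt I x x) •
    (LinearMap.mul ℝ ℝ).compl₁₂ (chartCovector b x j) (chartCovector b x k)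

theorem ricciForm_apply {ι : Type*} [Fintype ι] [DecidableEq ι] (b : Module.Basis ι ℝ E)
    (g : MetricField I M) (x : M) (X Y : TangentSpace I x) :
    ricciForm b g x X Y = ricci b g x X Y := by
  simp only [ricciForm, LinearMap.sum_apply, LinearMap.smul_apply, LinearMap.compl₁₂_apply,
    LinearMap.mul_apply', smul_eq_mul, ← mul_assoc]
  rfl

variable {E' : Type*} [NormedAddCommGroup E'] [NormedSpace ℝ E']
  {H' : Type*} [TopologicalSpace H'] {J : ModelWithCorners ℝ E' H'}
  {N : Type*} [TopologicalSpace N] [ChartedSpace H' N]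

theorem productMetric_apply (g : MetricField I M) (g' : MetricField J N) (z : M × N)
    (v w : TangentSpace (I.prod J) z) :
    productMetric g g' z v w = g z.1 (v : E × E').1 (w : E × E').1 +
      g' z.2 (v : E × E').2 (w : E × E').2 := by
  unfold productMetric
  rw [mfderiv_fst, mfderiv_snd]
  rfl

theorem productForm_apply {k l n : ℕ} (h : k + l = n) (τ : FormField I M k) (η : FormField J N l)
    (z : M × N) : productForm h τ η z =
      wedge (V := TangentSpace (I.prod J) z) h
      ((τ z.1).compContinuousLinearMap (ContinuousLinearMap.fst ℝ E E'))
      ((η z.2).compContinuousLinearMap (ContinuousLinearMap.snd ℝ E E')) := by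
  unfold productForm wedgeForm pullbackForm
  rw [mfderiv_fst, mfderiv_snd]
  rfl

theorem IsBosonicBackground.isTotallyRicciIsotropic_productForm_one
    [IsManifold I ∞ M] [IsManifold J ∞ N] [FiniteDimensional ℝ E] [FiniteDimensional ℝ E']
    {κ ι : Type*} [Fintype κ] [DecidableEq κ] [Fintype ι] [DecidableEq ι]
    {b₁ : Module.Basis κ ℝ E} {b : Module.Basis ι ℝ (E × E')}
    {g : MetricField I M} (hg : IsPseudoRiemannian g)
    {g' : MetricField J N} (hg' : IsPseudoRiemannian g')
    {ϖ : FormField I M 1} (hϖ : IsNullForm b₁ g ϖ) {ε : FormField J N 3}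
    {vol : FormField (I.prod J) (M × N) 11}
    (hF : IsBosonicBackground b (productMetric g g') vol (productForm rfl ϖ ε)) :
    IsTotallyRicciIsotropic b (productMetric g g') := by
  have : ∀ z : M × N, FiniteDimensional ℝ (TangentSpace (I.prod J) z) :=
    fun z => inferInstanceAs (FiniteDimensional ℝ (E × E'))
  have : ∀ x : M, FiniteDimensional ℝ (TangentSpace I x) :=
    fun z => inferInstanceAs (FiniteDimensional ℝ E)
  -- the metrics as linear maps
  let B₁ (x : M) : TangentSpace I x →ₗ[ℝ] TangentSpace I x →ₗ[ℝ] ℝ :=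
    LinearMap.mk₂ ℝ (fun v w => g x v w) (by simp) (by simp) (by simp) (by simp)
  let B (z : M × N) : TangentSpace (I.prod J) z →ₗ[ℝ] TangentSpace (I.prod J) z →ₗ[ℝ] ℝ :=
    LinearMap.mk₂ ℝ (fun v w => productMetric g g' z v w) (by simp) (by simp) (by simp) (by simp)
  have hsymm : ∀ z (v w : TangentSpace (I.prod J) z),
      productMetric g g' z v w = productMetric g g' z w v := fun z v w => by
    rw [productMetric_apply, productMetric_apply]
    exact congrArg₂ (· + ·) (hg.symm z.1 _ _) (hg'.symm z.2 _ _)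
  have hB : ∀ z v, (∀ w, B z v w = 0) → v = 0 := fun z v hv => by
    refine Prod.ext (hg.nondegenerate z.1 _ fun w => ?_) (hg'.nondegenerate z.2 _ fun w => ?_)
    · have := (productMetric_apply g g' z v ((w, 0) : E × E')).symm.trans (hv ((w, 0) : E × E'))
      rw [← this]
      exact (add_eq_left.2 (map_zero (g' z.2 (v : E × E').2))).symm
    · have := (productMetric_apply g g' z v ((0, w) : E × E')).symm.trans (hv ((0, w) : E × E'))
      rw [← this]
      exact (add_eq_right.2 (map_zero (g z.1 (v : E × E').1))).symm
  -- `ric z` is a linear section of `B z`, that is, the sharp map; composed with `ricciForm` it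
  -- becomes the Ricci endomorphism.
  choose ric hric using fun z =>
    LinearMap.exists_rightInverse_of_surjective (B z)
      (LinearMap.range_eq_top.2 (surjective_of_nondegenerate (B z) (hB z)))
  have hRic : ∀ z (X Y : TangentSpace (I.prod J) z),
      productMetric g g' z (ric z (ricciForm b (productMetric g g') z X)) Y =
        ricci b (productMetric g g') z X Y := fun z X Y =>
    (LinearMap.congr_fun (LinearMap.congr_fun (hric z) _) Y).trans (ricciForm_apply ..)
  refine ⟨fun z => ric z ∘ₗ ricciForm b (productMetric g g') z, hRic, fun z X Y => ?_⟩
  -- the sharp of the null form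
  obtain ⟨u₁, hu₁⟩ := surjective_of_nondegenerate (B₁ z.1) (fun v => hg.nondegenerate z.1 v)
    ((AlternatingMap.ofSubsingleton ℝ _ ℝ (0 : Fin 1)).symm (ϖ z.1).toAlternatingMap)
  have hu₁' : ∀ v, B₁ z.1 u₁ v = ϖ z.1 fun _ => v := fun v => LinearMap.congr_fun hu₁ v
  have hnull : (ϖ z.1 fun _ => u₁) = 0 :=
    apply_eq_zero_of_formInner_self_eq_zero (tangentBasis b₁ z.1) (B₁ z.1)
      (fun v => hg.nondegenerate z.1 v) u₁ (ϖ z.1).toAlternatingMap hu₁' (hϖ z.1)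
  let u : TangentSpace (I.prod J) z := ((u₁, 0) : E × E')
  let φ : TangentSpace (I.prod J) z [⋀^Fin 1]→L[ℝ] ℝ :=
    (ϖ z.1).compContinuousLinearMap (ContinuousLinearMap.fst ℝ E E')
  let ψ : TangentSpace (I.prod J) z [⋀^Fin 3]→L[ℝ] ℝ :=
    (ε z.2).compContinuousLinearMap (ContinuousLinearMap.snd ℝ E E')
  have hu : ∀ v, B z u v = φ fun _ => v := fun v => by
    refine (productMetric_apply g g' z u v).trans ?_
    refine Eq.trans ?_ (hu₁' (v : E × E').1)
    refine add_eq_left.2 ?_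
    exact (hg'.symm z.2 _ _).trans (map_zero (g' z.2 (v : E × E').2))
  have hφ : (φ fun _ => u) = 0 := hnull
  have hψ : ∀ v j, v j = u → ψ v = 0 := fun v j hv =>
    (ε z.2).map_coord_zero j (congrArg Prod.snd hv)
  have hFz : productForm rfl ϖ ε z = wedge rfl φ ψ := productForm_apply rfl ϖ ε z
  -- Both terms on the right of the Einstein equation vanish when `Z` lies in the kernel of `φ`.
  have hein : ∀ X Z : TangentSpace (I.prod J) z, (φ fun _ => Z) = 0 →
      ricci b (productMetric g g') z X Z = 0 := fun X Z hZ => by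
    have h₁ := formInner_wedge_one_self_eq_zero (n := 4) rfl φ ψ (tangentBasis b z) (B z) (hB z)
      hu hφ hψ
    have h₂ := formInner_interior_wedge_one_eq_zero (n := 3) (h := rfl) φ ψ (tangentBasis b z)
      (B z) (hB z) hu hφ hψ hZ X
    have h₃ := (formInner_comm _ (hsymm z) _ _).trans h₂
    rw [hF.einstein, hFz, innerAt, innerAt]
    exact (congrArg₂ (fun p q => -(1 / 2) * p + 1 / 6 * productMetric g g' z X Z * q) h₃ h₁).trans
      (by simp)
  -- It remains to see that `ric Y` lies in the kernel of `φ`; there `φ` is rewritten as pairing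
  -- with `u`, and `hein` applies with `Z = u`.
  refine (hRic z X _).trans (hein X _ ?_)
  rw [← hu]
  exact (hsymm z _ _).trans ((hRic z Y u).trans (hein Y u hφ))

end Manifold
end Sugra

theorem mainTheorem8
    {Mt : Type*} [TopologicalSpace Mt] [T2Space Mt] [SecondCountableTopology Mt] [ConnectedSpace Mt]
    [ChartedSpace (EuclideanSpace ℝ (Fin 5)) Mt] [IsManifold (𝓡 5) ∞ Mt]
    {M : Type*} [TopologicalSpace M] [T2Space M] [SecondCountableTopology M] [ConnectedSpace M]
    [ChartedSpace (EuclideanSpace ℝ (Fin 6)) M] [IsManifold (𝓡 6) ∞ M]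
    (gt : Sugra.MetricField (𝓡 5) Mt) (hgt : Sugra.IsLorentzian 5 gt)
    (g : Sugra.MetricField (𝓡 6) M) (hg : Sugra.IsNegRiemannian g)
    (ot : ∀ x : Mt, Orientation ℝ (TangentSpace (𝓡 5) x) (Fin 5))
    (hot : Sugra.IsManifoldOrientation ot)
    (o : ∀ x : M, Orientation ℝ (TangentSpace (𝓡 6) x) (Fin 6))
    (ho : Sugra.IsManifoldOrientation o)
    (ϖ : Sugra.FormField (𝓡 5) Mt 1) (hϖ : Sugra.IsSmoothForm ϖ)
    (hnull : Sugra.IsNullForm (Sugra.stdBasis 5) gt ϖ)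
    (ε : Sugra.FormField (𝓡 6) M 3) (hε : Sugra.IsSmoothForm ε)
    (hF : Sugra.IsBosonicBackground (Sugra.stdBasisProd 5 6) (Sugra.productMetric gt g)
      (Sugra.productForm rfl (Sugra.volumeForm (Sugra.stdBasis 5) gt ot)
        (Sugra.volumeForm (Sugra.stdBasis 6) g o))
      (Sugra.productForm rfl ϖ ε)) :
    Sugra.IsTotallyRicciIsotropic (Sugra.stdBasisProd 5 6) (Sugra.productMetric gt g) :=
  hF.isTotallyRicciIsotropic_productForm_one hgt.toIsPseudoRiemannian hg.toIsPseudoRiemannian hnull
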